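/- Let $p,q\ge 1$ be integers, $n=p+q$, and $X=\{1,\dots,n\}\cup\{-1,\dots,-n\}$. Let $B_n$ be the hyperoctahedral group of all permutations $\tau$ of $X$ with $\tau(-i)=-\tau(i)$ for all $i$. For $\tau\in B_n$ let $\ell_B(\tau)$ be the smallest $k$ such that $\tau$ is a product of $k$ elements of the set $$\{(i,j)(-i,-j),\ (i,-j)(-i,j) : 1\le i<j\le n\}\cup\{(i,-i): 1\le i\le n\},$$ and order $B_n$ partially by $$\sigma\le\tau \iff \ell_B(\tau)=\ell_B(\sigma)+\ell_B(\sigma^{-1}\tau).$$ For permutations $\tau,\gamma$ of $X$ let $\#(\tau)$ be the number of orbits of $\tau$ (fixed points included), and let $\#(\tau,\gamma)$ be the number of orbits on $X$ of the group generated by $\tau$ and $\gamma$. Put $$\gamma=(1,\dots,p,-1,\dots,-p)(p+1,\dots,n,-(p+1),\dots,-n),$$ and let $\mathcal S^B_{nc}(p,q)$ be the set of all $\tau\in B_n$ such that $$\#(\tau)+\#(\tau^{-1}\gamma)+\#(\gamma)=|X|+2\,\#(\tau,\gamma),$$ with the partial order induced from $B_n$. For $\tau\in B_n$ let $\Omega(\tau)$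 be the partition of $X$ into the orbits of $\tau$; a block $A$ is called a zero-block if $A=-A$. Let $\widetilde\Omega(\tau)$ be the partition of $X$ obtained from $\Omega(\tau)$ by replacing all the zero-blocks, if there are any, by their union. Let $$NC^B(p,q)=\{\widetilde\Omega(\tau):\tau\in\mathcal S^B_{nc}(p,q)\},$$ partially ordered by reverse refinement: $\pi\le\rho$ if and only if every block of $\rho$ is a union of blocks of $\pi$. Theorem. The map $\mathcal S^B_{nc}(p,q)\to NC^B(p,q)$, $\tau\mapsto\widetilde\Omega(\tau)$, is bijective and is an isomorphism of partially ordered sets: for all $\sigma,\tau\in\mathcal S^B_{nc}(p,q)$ one has $\sigma\le\tau$ in $B_n$ if and only if $\widetilde\Omega(\sigma)\le\widetilde\Omega(\tau)$. -/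

import Mathlib

open Equiv
open scoped Pointwise

namespace AnnularNC

/-- The orbit partition `Ω(τ)` of a permutation `τ` of a finite set `X`. -/
def orbitPartition {X : Type*} [Fintype X] [DecidableEq X] (τ : Perm X) :
    Finpartition (Finset.univ : Finset X) :=
  letI : DecidableRel (Perm.SameCycle.setoid τ).r :=
    inferInstanceAs (DecidableRel (Perm.SameCycle τ))
  Finpartition.ofSetoid (Perm.SameCycle.setoid τ)

lemma mem_part_orbitPartition {X : Type*} [Fintype X] [DecidableEq X] (τ : Perm X) (x y : X) :
    y ∈ (orbitPartition τ).part x ↔ τ.SameCycle x y := by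
  letI : DecidableRel (Perm.SameCycle.setoid τ).r :=
    inferInstanceAs (DecidableRel (Perm.SameCycle τ))
  exact Finpartition.mem_part_ofSetoid_iff_rel (s := Perm.SameCycle.setoid τ)

/-- The number `#(τ)` of orbits of `τ`, fixed points included. -/
def numOrbits {X : Type*} [Fintype X] [DecidableEq X] (τ : Perm X) : ℕ :=
  (orbitPartition τ).parts.card

/-- The number `#(τ, γ)` of orbits of the action on `X` of the subgroup generated by
`τ` and `γ`. -/
noncomputable def numJointOrbits {X : Type*} (τ γ : Perm X) : ℕ :=
  Nat.card (MulAction.orbitRel.Quotient (Subgroup.closure ({τ, γ} : Set (Perm X))) X)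

/-- The set `S_nc(X, γ)` of non-crossing permutations of `X` with respect to `γ`
(genus zero). -/
def nonCrossing {X : Type*} [Fintype X] [DecidableEq X] (γ : Perm X) : Set (Perm X) :=
  {τ | numOrbits τ + numOrbits (τ⁻¹ * γ) + numOrbits γ
    = Fintype.card X + 2 * numJointOrbits τ γ}

/-- The set `{1, …, n} ∪ {-1, …, -n}`. -/
abbrev Signed (n : ℕ) : Type := ↥((Finset.Icc (-(n : ℤ)) (n : ℤ)).erase 0)

lemma Signed.bounds {n : ℕ} (x : Signed n) :
    (x : ℤ) ≠ 0 ∧ -(n : ℤ) ≤ (x : ℤ) ∧ (x : ℤ) ≤ n := by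
  have h := x.2
  simpa only [Finset.mem_erase, Finset.mem_Icc] using h

/-- The sign change `i ↦ -i` on `{1, …, n} ∪ {-1, …, -n}`. -/
instance (n : ℕ) : InvolutiveNeg (Signed n) where
  neg x := ⟨-(x : ℤ), by
    have h := x.bounds
    simp only [Finset.mem_erase, Finset.mem_Icc]
    omega⟩
  neg_neg x := Subtype.ext (neg_neg (x : ℤ))

@[simp] lemma Signed.coe_neg {n : ℕ} (x : Signed n) : ((-x : Signed n) : ℤ) = -(x : ℤ) := rfl

lemma Signed.neg_ne {n : ℕ} (x : Signed n) : -x ≠ x := by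
  intro h
  have h1 := congrArg (fun y : Signed n => (y : ℤ)) h
  have h2 := x.bounds
  simp only [Signed.coe_neg] at h1
  omega

/-- The hyperoctahedral group `B_n`, as a subgroup of the group of all permutations of
`{1, …, n} ∪ {-1, …, -n}`. -/
def hyperoctahedral (n : ℕ) : Subgroup (Perm (Signed n)) where
  carrier := {τ | ∀ x, τ (-x) = -τ x}
  one_mem' := fun _ => rfl
  mul_mem' := by
    intro a b ha hb x
    change ∀ x, a (-x) = -a x at ha
    change ∀ x, b (-x) = -b x at hb
    rw [Perm.mul_apply, Perm.mul_apply, hb, ha]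
  inv_mem' := by
    intro a ha x
    change ∀ x, a (-x) = -a x at ha
    rw [Perm.inv_eq_iff_eq, ha]
    exact congrArg Neg.neg (a.apply_symm_apply x).symm

/-- The generators of `B_n`: `(i,j)(-i,-j)` and `(i,-j)(-i,j)` for `1 ≤ i < j ≤ n`, and
`(i,-i)` for `1 ≤ i ≤ n`. -/
def reflections (n : ℕ) : Set (Perm (Signed n)) :=
  {g | ∃ i j : Signed n, 0 < (i : ℤ) ∧ (i : ℤ) < (j : ℤ) ∧ g = swap i j * swap (-i) (-j)} ∪
  {g | ∃ i j : Signed n, 0 < (i : ℤ) ∧ (i : ℤ) < (j : ℤ) ∧ g = swap i (-j) * swap (-i) j} ∪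
  {g | ∃ i : Signed n, 0 < (i : ℤ) ∧ g = swap i (-i)}

/-- The length `ℓ_B(τ)`: the smallest `k` such that `τ` is a product of `k` generators.
Every element of `B_n` is such a product, see `exists_factorization`. -/
noncomputable def length {n : ℕ} (τ : hyperoctahedral n) : ℕ :=
  sInf {k | ∃ l : List (Perm (Signed n)),
    l.length = k ∧ (∀ g ∈ l, g ∈ reflections n) ∧ l.prod = (τ : Perm (Signed n))}

/-! The generators do generate `B_n`. -/

lemma swap_mem_reflections {n : ℕ} (x : Signed n) : swap x (-x) ∈ reflections n := by
  have hb := x.bounds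
  rcases lt_or_gt_of_ne hb.1 with h | h
  · refine Or.inr ⟨-x, ?_, ?_⟩
    · rw [Signed.coe_neg]; omega
    · rw [neg_neg, swap_comm]
  · exact Or.inr ⟨x, h, rfl⟩

lemma swap_mul_swap_comm {n : ℕ} {x y : Signed n} (h1 : y ≠ x) (h2 : y ≠ -x) :
    swap x y * swap (-x) (-y) = swap (-x) (-y) * swap x y := by
  have h3 : -y ≠ x := fun h => h2 (by rw [← h, neg_neg])
  have h4 : -y ≠ -x := fun h => h1 (neg_injective h)
  have h5 := x.neg_ne
  have h6 := y.neg_ne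
  ext1 z
  simp only [Perm.mul_apply]
  grind

lemma swap_mul_swap_mem_aux {n : ℕ} {x y : Signed n} (hx : 0 < (x : ℤ))
    (h1 : y ≠ x) (h2 : y ≠ -x) : swap x y * swap (-x) (-y) ∈ reflections n := by
  have hxb := x.bounds
  have hyb := y.bounds
  have h1' : (y : ℤ) ≠ x := fun h => h1 (Subtype.ext h)
  have h2' : (y : ℤ) ≠ -x := fun h => h2 (Subtype.ext h)
  have hc := swap_mul_swap_comm h1 h2
  rcases lt_or_gt_of_ne hyb.1 with h | h
  · rcases lt_or_gt_of_ne h2' with h' | h'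
    · refine Or.inl (Or.inr ⟨x, -y, hx, ?_, ?_⟩)
      · rw [Signed.coe_neg]; omega
      · rw [neg_neg]
    · refine Or.inl (Or.inr ⟨-y, x, ?_, ?_, ?_⟩)
      · rw [Signed.coe_neg]; omega
      · rw [Signed.coe_neg]; omega
      · rw [neg_neg, hc, swap_comm (-x), swap_comm x]
  · rcases lt_or_gt_of_ne h1' with h' | h'
    · refine Or.inl (Or.inl ⟨y, x, h, h', ?_⟩)
      rw [swap_comm x, swap_comm (-x)]
    · exact Or.inl (Or.inl ⟨x, y, hx, h', rfl⟩)

lemma swap_mul_swap_mem {n : ℕ} {x y : Signed n} (h1 : y ≠ x) (h2 : y ≠ -x) :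
    swap x y * swap (-x) (-y) ∈ reflections n := by
  rcases lt_or_gt_of_ne x.bounds.1 with h | h
  · have h3 : -y ≠ -x := fun h => h1 (neg_injective h)
    have h4 : -y ≠ - -x := fun h => h2 (neg_injective h)
    have h5 := swap_mul_swap_mem_aux (x := -x) (y := -y)
      (by rw [Signed.coe_neg]; omega) h3 h4
    rw [neg_neg, neg_neg] at h5
    rwa [swap_mul_swap_comm h1 h2]
  · exact swap_mul_swap_mem_aux h h1 h2

lemma reflections_subset {n : ℕ} {g : Perm (Signed n)} (hg : g ∈ reflections n) :
    g ∈ hyperoctahedral n ∧ g * g = 1 := by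
  have key : ∀ x y : Signed n, y ≠ x → y ≠ -x →
      swap x y * swap (-x) (-y) ∈ hyperoctahedral n ∧
      (swap x y * swap (-x) (-y)) * (swap x y * swap (-x) (-y)) = 1 := by
    intro x y h1 h2
    have h3 : -y ≠ x := fun h => h2 (by rw [← h, neg_neg])
    have h4 : -y ≠ -x := fun h => h1 (neg_injective h)
    have h5 := x.neg_ne
    have h6 := y.neg_ne
    constructor
    · intro z
      have hz : ∀ w : Signed n, (-z = w ↔ z = -w) := fun w => neg_eq_iff_eq_neg
      simp only [Perm.mul_apply]
      have e1 := neg_neg x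
      have e2 := neg_neg y
      have e3 := neg_neg z
      have := z.neg_ne
      have hzx := hz x
      have hzy := hz y
      have hzx' := hz (-x)
      have hzy' := hz (-y)
      grind
    · ext1 z
      simp only [Perm.mul_apply, Perm.one_apply]
      grind
  have hne : ∀ i j : Signed n, 0 < (i : ℤ) → (i : ℤ) < (j : ℤ) → j ≠ i ∧ j ≠ -i := by
    intro i j h1 h2
    constructor
    · rintro rfl; omega
    · rintro rfl; rw [Signed.coe_neg] at h2; omega
  rcases hg with (⟨i, j, h1, h2, rfl⟩ | ⟨i, j, h1, h2, rfl⟩) | ⟨i, h1, rfl⟩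
  · exact key i j (hne i j h1 h2).1 (hne i j h1 h2).2
  · have h := key i (-j) (fun h => (hne i j h1 h2).2 (by rw [← h, neg_neg]))
      (fun h => (hne i j h1 h2).1 (neg_injective h))
    rwa [neg_neg] at h
  · constructor
    · intro z
      have hzx : -z = i ↔ z = -i := neg_eq_iff_eq_neg
      have hzx' : -z = -i ↔ z = i := neg_inj
      have e1 := neg_neg i
      grind
    · exact swap_mul_self _ _

lemma exists_factorization {n : ℕ} (τ : hyperoctahedral n) :
    ∃ l : List (Perm (Signed n)),
      (∀ g ∈ l, g ∈ reflections n) ∧ l.prod = (τ : Perm (Signed n)) := by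
  obtain ⟨τ, hτ⟩ := τ
  induction hk : τ.support.card using Nat.strong_induction_on generalizing τ with
  | _ k ih =>
    by_cases h1 : τ = 1
    · exact ⟨[], by simp, by simp [h1]⟩
    obtain ⟨x, hx⟩ : ∃ x, τ x ≠ x := by
      by_contra! h
      exact h1 (Perm.ext h)
    have hneg : τ (-x) = -τ x := hτ x
    obtain ⟨g, hg, hgx, hgs⟩ : ∃ g ∈ reflections n, g (τ x) = x ∧
        ∀ z, τ z = z → g z = z := by
      by_cases h2 : τ x = -x
      · refine ⟨swap x (-x), swap_mem_reflections x, by rw [h2, swap_apply_right], ?_⟩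
        intro z hz
        refine swap_apply_of_ne_of_ne ?_ ?_
        · rintro rfl; exact hx hz
        · rintro rfl
          rw [hneg, h2] at hz
          exact (-x).neg_ne hz
      · refine ⟨_, swap_mul_swap_mem hx h2, ?_, ?_⟩
        · have h3 := (τ x).neg_ne
          rw [Perm.mul_apply, swap_apply_of_ne_of_ne h2 h3.symm, swap_apply_right]
        · intro z hz
          have hzx : z ≠ x := by rintro rfl; exact hx hz
          have hzx' : z ≠ -x := by
            rintro rfl
            rw [hneg] at hz
            exact hx (neg_injective hz)
          have hzy : z ≠ τ x := by
            intro h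
            exact hzx (τ.injective (hz.trans h))
          have hzy' : z ≠ -τ x := by
            intro h
            exact hzx' (τ.injective (hz.trans (h.trans hneg.symm)))
          rw [Perm.mul_apply, swap_apply_of_ne_of_ne hzx' hzy',
            swap_apply_of_ne_of_ne hzx hzy]
    obtain ⟨hgB, hgg⟩ := reflections_subset hg
    have hlt : (g * τ).support.card < k := by
      rw [← hk]
      refine Finset.card_lt_card ⟨?_, ?_⟩
      · intro z hz
        rw [Perm.mem_support] at hz ⊢
        intro h
        exact hz (by rw [Perm.mul_apply, h, hgs z h])
      · intro h
        have h3 := h (Perm.mem_support.2 hx)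
        rw [Perm.mem_support, Perm.mul_apply] at h3
        exact h3 hgx
    obtain ⟨l, hl, hp⟩ := ih _ hlt (g * τ) (mul_mem hgB hτ) rfl
    refine ⟨g :: l, ?_, ?_⟩
    · intro f hf
      rcases List.mem_cons.1 hf with rfl | hf
      · exact hg
      · exact hl f hf
    · rw [List.prod_cons, hp]
      change g * (g * τ) = τ
      rw [← mul_assoc, hgg, one_mul]

lemma length_spec {n : ℕ} (τ : hyperoctahedral n) :
    ∃ l : List (Perm (Signed n)),
      l.length = length τ ∧ (∀ g ∈ l, g ∈ reflections n) ∧ l.prod = (τ : Perm (Signed n)) := by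
  obtain ⟨l, hl⟩ := exists_factorization τ
  exact Nat.sInf_mem (s := {k | ∃ l : List (Perm (Signed n)),
    l.length = k ∧ (∀ g ∈ l, g ∈ reflections n) ∧ l.prod = (τ : Perm (Signed n))})
    ⟨l.length, l, rfl, hl⟩

lemma length_one {n : ℕ} : length (1 : hyperoctahedral n) = 0 :=
  Nat.sInf_eq_zero.2 (Or.inl ⟨[], rfl, by simp, by simp⟩)

lemma eq_one_of_length_eq_zero {n : ℕ} {τ : hyperoctahedral n} (h : length τ = 0) : τ = 1 := by
  obtain ⟨l, h1, -, h3⟩ := length_spec τ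
  rw [h, List.length_eq_zero_iff] at h1
  subst h1
  exact Subtype.ext h3.symm

lemma length_mul_le {n : ℕ} (σ τ : hyperoctahedral n) :
    length (σ * τ) ≤ length σ + length τ := by
  obtain ⟨l, h1, h2, h3⟩ := length_spec σ
  obtain ⟨m, k1, k2, k3⟩ := length_spec τ
  refine Nat.sInf_le ⟨l ++ m, by rw [List.length_append, h1, k1], ?_, ?_⟩
  · intro g hg
    rcases List.mem_append.1 hg with h | h
    · exact h2 g h
    · exact k2 g h
  · rw [List.prod_append, h3, k3]; rfl

/-- The partial order on `B_n`: `σ ≤ τ` if and only if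
`ℓ_B(τ) = ℓ_B(σ) + ℓ_B(σ⁻¹ τ)`. -/
instance (n : ℕ) : PartialOrder (hyperoctahedral n) where
  le σ τ := length τ = length σ + length (σ⁻¹ * τ)
  le_refl σ := by simp [length_one]
  le_trans ρ σ τ h1 h2 := by
    change length σ = length ρ + length (ρ⁻¹ * σ) at h1
    change length τ = length σ + length (σ⁻¹ * τ) at h2
    have h3 := length_mul_le (ρ⁻¹ * σ) (σ⁻¹ * τ)
    have h4 := length_mul_le ρ (ρ⁻¹ * τ)
    rw [mul_assoc, mul_inv_cancel_left] at h3
    rw [mul_inv_cancel_left] at h4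
    omega
  le_antisymm σ τ h1 h2 := by
    change length τ = length σ + length (σ⁻¹ * τ) at h1
    change length σ = length τ + length (τ⁻¹ * σ) at h2
    have h3 : length (σ⁻¹ * τ) = 0 := by omega
    exact inv_mul_eq_one.1 (eq_one_of_length_eq_zero h3)

lemma le_def {n : ℕ} (σ τ : hyperoctahedral n) :
    σ ≤ τ ↔ length τ = length σ + length (σ⁻¹ * τ) := Iff.rfl

/-- The map underlying `γ = (1, …, p, -1, …, -p)(p+1, …, n, -(p+1), …, -n)`, `n = p + q`. -/
def gammaFun (p q : ℕ) (x : Signed (p + q)) : Signed (p + q) :=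
  ⟨if (x : ℤ) = p then -1
    else if (x : ℤ) = -p then 1
    else if (x : ℤ) = p + q then -(p + 1)
    else if (x : ℤ) = -(p + q) then p + 1
    else if 0 < (x : ℤ) then x + 1
    else x - 1, by
    have h := x.bounds
    simp only [Finset.mem_erase, Finset.mem_Icc]
    push_cast at h ⊢
    split_ifs <;> omega⟩

lemma gammaFun_injective (p q : ℕ) : Function.Injective (gammaFun p q) := by
  intro x y h
  have h := congrArg (fun z : Signed (p + q) => (z : ℤ)) h
  have hx := x.bounds
  have hy := y.bounds
  refine Subtype.ext ?_
  simp only [gammaFun] at h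
  push_cast at hx hy
  split_ifs at h <;> omega

/-- The permutation `γ = (1, …, p, -1, …, -p)(p+1, …, n, -(p+1), …, -n)`, `n = p + q`. -/
noncomputable def gamma (p q : ℕ) : Perm (Signed (p + q)) :=
  Equiv.ofBijective (gammaFun p q)
    (Finite.injective_iff_bijective.1 (gammaFun_injective p q))

/-- The set `S^B_nc(p,q) = S_nc(X, γ) ∩ B_n` of annular non-crossing permutations of type B,
as a set of elements of `B_n`, `n = p + q`. Its order is the one induced from `B_n`. -/
def SBnc (p q : ℕ) : Set (hyperoctahedral (p + q)) :=
  {τ | (τ : Perm (Signed (p + q))) ∈ nonCrossing (gamma p q)}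

/-- The zero-blocks of a partition of `{1, …, n} ∪ {-1, …, -n}`: the blocks `A` with
`A = -A`. -/
def zeroBlocks {n : ℕ} (π : Finpartition (Finset.univ : Finset (Signed n))) :
    Finset (Finset (Signed n)) :=
  π.parts.filter fun A => A = -A

/-- The partition obtained from `π` by merging all its zero-blocks into one block. (If there
are no zero-blocks, then their union is empty, and `Finpartition.ofErase` drops it.) -/
noncomputable def mergeZeroBlocks {n : ℕ} (π : Finpartition (Finset.univ : Finset (Signed n))) :
    Finpartition (Finset.univ : Finset (Signed n)) :=
  Finpartition.ofErase ((π.parts \ zeroBlocks π) ∪ {(zeroBlocks π).sup id})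
    (by
      have hd : ∀ A ∈ π.parts \ zeroBlocks π, Disjoint A ((zeroBlocks π).sup id) := by
        intro A hA
        rw [Finset.mem_sdiff] at hA
        rw [Finset.disjoint_sup_right]
        intro C hC
        refine π.disjoint hA.1 (Finset.mem_filter.1 hC).1 ?_
        rintro rfl
        exact hA.2 hC
      rw [Finset.supIndep_iff_pairwiseDisjoint]
      intro A hA C hC hAC
      simp only [Finset.coe_union, Finset.coe_singleton, Set.mem_union, Finset.mem_coe,
        Set.mem_singleton_iff] at hA hC
      rcases hA with hA | rfl <;> rcases hC with hC | rfl
      · exact π.disjoint (Finset.mem_sdiff.1 hA).1 (Finset.mem_sdiff.1 hC).1 hAC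
      · exact hd A hA
      · exact (hd C hC).symm
      · exact absurd rfl hAC)
    (by
      have h := π.sup_parts
      have hz : zeroBlocks π ⊆ π.parts := Finset.filter_subset _ _
      rw [Finset.sup_union, Finset.sup_singleton, id, ← Finset.sup_union,
        Finset.sdiff_union_of_subset hz, h])

/-- The partition `Ω̃(τ)`: the orbit partition of `τ` with all zero-blocks merged into one. -/
noncomputable def omegaTilde {n : ℕ} (τ : hyperoctahedral n) :
    Finpartition (Finset.univ : Finset (Signed n)) :=
  mergeZeroBlocks (orbitPartition (τ : Perm (Signed n)))

/-- The order of `Finpartition` is reverse refinement: `π ≤ ρ` if and only if every block of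
`ρ` is a union of blocks of `π`. -/
lemma finpartition_le_iff {X : Type*} [Fintype X] [DecidableEq X]
    (π ρ : Finpartition (Finset.univ : Finset X)) :
    π ≤ ρ ↔ ∀ B ∈ ρ.parts, ∃ S ⊆ π.parts, B = S.sup id := by
  constructor
  · intro h B hB
    refine ⟨π.parts.filter (fun A => A ⊆ B), Finset.filter_subset _ _, ?_⟩
    ext x
    simp only [Finset.mem_sup, Finset.mem_filter, id]
    constructor
    · intro hx
      obtain ⟨A, hA, hxA⟩ := π.exists_mem (Finset.mem_univ x)
      obtain ⟨C, hC, hAC⟩ := h hA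
      have : C = B := ρ.eq_of_mem_parts hC hB (hAC hxA) hx
      exact ⟨A, ⟨hA, this ▸ hAC⟩, hxA⟩
    · rintro ⟨A, ⟨-, hAB⟩, hxA⟩
      exact hAB hxA
  · intro h A hA
    obtain ⟨x, hx⟩ := π.nonempty_of_mem_parts hA
    obtain ⟨B, hB, hxB⟩ := ρ.exists_mem (Finset.mem_univ x)
    refine ⟨B, hB, ?_⟩
    obtain ⟨S, hS, rfl⟩ := h B hB
    obtain ⟨C, hC, hxC⟩ := Finset.mem_sup.1 hxB
    have : C = A := π.eq_of_mem_parts (hS hC) hA hxC hx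
    subst this
    exact Finset.le_sup (f := id) hC

/-- The set `NC^B(p,q) = {Ω̃(τ) | τ ∈ S^B_nc(p,q)}` of annular non-crossing partitions of
type B, ordered by reverse refinement (the order of `Finpartition`). -/
def NCB (p q : ℕ) : Set (Finpartition (Finset.univ : Finset (Signed (p + q)))) :=
  {π | ∃ τ ∈ SBnc p q, omegaTilde τ = π}

/-- The map `S^B_nc(p,q) → NC^B(p,q)`, `τ ↦ Ω̃(τ)`. -/
noncomputable def omegaTildeMap (p q : ℕ) (τ : SBnc p q) : NCB p q :=
  ⟨omegaTilde τ.1, τ.1, τ.2, rfl⟩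

end AnnularNC

open AnnularNC

/-!
The proof is linear algebra on the space of real functions on `X = {±1, …, ±n}`, on which `τ ∈ B_n`
acts by `f ↦ f ∘ τ`. Functions split into even and odd ones; let `Fix τ` be the space of odd
`τ`-invariant functions and `Mov τ` the image of `f ↦ f ∘ τ - f` on odd functions. These are
orthogonal complements of each other.

* The length of `τ` is `dim Mov τ` (`length_add_finrank`): a reflection changes `Fix` by at most
  one dimension, and every `τ ≠ 1` can be shortened by a reflection.
* `Ω̃(τ)` is the partition whose blocks are separated by `Fix τ`, the merged zero-block being the
  place where all odd invariants vanish. Hence `Ω̃(σ) ≤ Ω̃(τ)` iff `Fix τ ≤ Fix σ`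
  (`omegaTilde_le_iff`).
* Every `τ` in `S^B_nc(p,q)` satisfies `τ ≤ γ` (`le_gamma_of_mem_SBnc`). The numbers of orbits in
  the genus-zero condition are dimensions of spaces of invariants, hence sums of an even and an odd
  contribution. Scott's inequality bounds the even contribution (all `γ`-invariant functions are
  even), subadditivity of the length bounds the odd one, and the genus-zero condition forces
  equality in both; the second equality is `τ ≤ γ`.
* For `σ, τ ≤ γ` with `Fix γ = 0`, the inclusion `Fix τ ≤ Fix σ` implies `σ ≤ τ`
  (`le_of_oddInvariants_le`). This is the argument of Brady and Watt for the orthogonal group: an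
  element below `γ` agrees with `γ` on the preimage under `γ - 1` of its moved space and with the
  identity on its fixed space, so `σ` and `τ` agree on a space of dimension
  `dim Fix τ + dim Mov σ`. The converse is a dimension count (`oddInvariants_le_of_le`).

So `Ω̃` reflects and preserves the order, which also gives injectivity; surjectivity holds by
definition of `NC^B(p,q)`.
-/

namespace AnnularNC

open Module

/-! ### Fixed and moved spaces of linear isometries -/

section LinearAlgebra

variable {V : Type*} [NormedAddCommGroup V] [InnerProductSpace ℝ V]

lemma orthogonal_range_sub_one {A : V →ₗ[ℝ] V} (hA : ∀ v, ‖A v‖ = ‖v‖) :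
    (LinearMap.range (A - 1))ᗮ = LinearMap.ker (A - 1) := by
  have hinner (v w : V) : inner ℝ (A v) (A w) = inner ℝ v w :=
    (LinearMap.norm_map_iff_inner_map_map A).1 hA v w
  ext w
  rw [Submodule.mem_orthogonal', LinearMap.mem_ker]
  simp only [LinearMap.mem_range, forall_exists_index, forall_apply_eq_imp_iff,
    LinearMap.sub_apply, Module.End.one_apply, inner_sub_right]
  constructor
  · intro h
    have h1 : ‖A w - w‖ ^ 2 = 0 := by
      rw [norm_sub_sq_real, hA, real_inner_comm, sub_eq_zero.1 (h w), real_inner_self_eq_norm_sq]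
      ring
    simpa using h1
  · intro h v
    nth_rewrite 1 [← sub_eq_zero.1 h]
    rw [hinner, sub_self]

/-- If `A = C * B` is a factorization with independent moved spaces, then `A` and `B` agree on the
preimage under `A - 1` of the moved space of `B`. -/
lemma apply_eq_of_sub_one_mem_range {C B : V →ₗ[ℝ] V}
    (h : Disjoint (LinearMap.range (C - 1)) (LinearMap.range (B - 1))) {v : V}
    (hv : (C * B - 1) v ∈ LinearMap.range (B - 1)) : (C * B) v = B v := by
  have e : (C - 1) (B v) = (C * B - 1) v - (B - 1) v := by simp
  have h0 : (C - 1) (B v) = 0 :=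
    Submodule.disjoint_def.1 h _ ⟨_, rfl⟩ (e ▸ Submodule.sub_mem _ hv ⟨_, rfl⟩)
  exact sub_eq_zero.1 h0

variable [FiniteDimensional ℝ V]

lemma range_sub_one_le_of_ker_le {A B : V →ₗ[ℝ] V} (hA : ∀ v, ‖A v‖ = ‖v‖)
    (hB : ∀ v, ‖B v‖ = ‖v‖) (h : LinearMap.ker (B - 1) ≤ LinearMap.ker (A - 1)) :
    LinearMap.range (A - 1) ≤ LinearMap.range (B - 1) := by
  rw [← orthogonal_range_sub_one hA, ← orthogonal_range_sub_one hB] at h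
  exact (Submodule.orthogonal_le_orthogonal_iff).1 h

/-- Scott's inequality for the triple `A`, `B`, `(A * B)⁻¹`: in terms of the codimensions `c` of the
fixed spaces, `c A + c B + c (A * B) ≥ 2 (dim V - dim W)`, where `W` is the space of common fixed
vectors. -/
lemma scott_inequality {A B : V →ₗ[ℝ] V} (hA : ∀ v, ‖A v‖ = ‖v‖) (hB : ∀ v, ‖B v‖ = ‖v‖) :
    finrank ℝ (LinearMap.ker (A - 1)) + finrank ℝ (LinearMap.ker (B - 1)) +
      finrank ℝ (LinearMap.ker (A * B - 1)) ≤ finrank ℝ V +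
        2 * finrank ℝ (LinearMap.ker (A - 1) ⊓ LinearMap.ker (B - 1) : Submodule ℝ V) := by
  set MA := LinearMap.range (A - 1) with hMA
  set MB := LinearMap.range (B - 1) with hMB
  -- `A * B - 1 = (A - 1) * B + (B - 1)` factors as `δ ∘ β` through `MA × MB`
  let β : V →ₗ[ℝ] MA × MB :=
    ((A - 1).rangeRestrict ∘ₗ B).prod (B - 1).rangeRestrict
  let δ : MA × MB →ₗ[ℝ] V := MA.subtype.coprod MB.subtype
  have hβker : LinearMap.ker β = LinearMap.ker (A - 1) ⊓ LinearMap.ker (B - 1) := by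
    ext v
    have h1 : v ∈ LinearMap.ker β ↔ A (B v) - B v = 0 ∧ B v - v = 0 := by
      simp [β, LinearMap.mem_ker]
    rw [h1]
    simp only [Submodule.mem_inf, LinearMap.mem_ker, LinearMap.sub_apply, Module.End.one_apply]
    constructor
    · rintro ⟨h, h'⟩
      rw [sub_eq_zero.1 h'] at h
      exact ⟨h, h'⟩
    · rintro ⟨h, h'⟩
      refine ⟨?_, h'⟩
      rw [sub_eq_zero.1 h', h]
  have hδ : LinearMap.range δ = MA ⊔ MB := by
    rw [LinearMap.range_coprod, Submodule.range_subtype, Submodule.range_subtype]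
  have hδβ : δ ∘ₗ β = A * B - 1 := by
    ext v
    simp [δ, β]
  have horth : (MA ⊔ MB)ᗮ = LinearMap.ker (A - 1) ⊓ LinearMap.ker (B - 1) := by
    rw [← Submodule.inf_orthogonal, orthogonal_range_sub_one hA, orthogonal_range_sub_one hB]
  have e1 := LinearMap.finrank_range_add_finrank_ker (A - 1)
  have e2 := LinearMap.finrank_range_add_finrank_ker (B - 1)
  have e3 := LinearMap.finrank_range_add_finrank_ker (A * B - 1)
  have e4 := LinearMap.finrank_range_add_finrank_ker β
  have e5 := LinearMap.finrank_range_add_finrank_ker δ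
  have e6 := Submodule.finrank_add_finrank_orthogonal (MA ⊔ MB)
  have e7 := LinearMap.finrank_range_add_finrank_ker (δ.domRestrict (LinearMap.range β))
  have e8 : LinearMap.range (δ.domRestrict (LinearMap.range β)) = LinearMap.range (A * B - 1) := by
    rw [← hδβ, LinearMap.range_domRestrict, LinearMap.range_comp]
  have e9 : finrank ℝ (LinearMap.ker (δ.domRestrict (LinearMap.range β)))
      ≤ finrank ℝ (LinearMap.ker δ) := by
    rw [LinearMap.ker_domRestrict, ← Submodule.finrank_map_subtype_eq]
    refine Submodule.finrank_mono ?_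
    rw [Submodule.map_comap_subtype]
    exact inf_le_right
  rw [← hMA] at e1
  rw [← hMB] at e2
  rw [hδ] at e5
  rw [horth] at e6
  rw [hβker] at e4
  rw [e8] at e7
  rw [Module.finrank_prod] at e5
  omega

/-- The moved space of `C * B` lies in the sum of those of `C` and `B`, so if its dimension is the
sum of theirs, then this sum is direct. -/
lemma disjoint_range_sub_one {C B : V →ₗ[ℝ] V}
    (h : finrank ℝ (LinearMap.range (C - 1)) + finrank ℝ (LinearMap.range (B - 1)) ≤
      finrank ℝ (LinearMap.range (C * B - 1))) :
    Disjoint (LinearMap.range (C - 1)) (LinearMap.range (B - 1)) := by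
  have hle : LinearMap.range (C * B - 1) ≤
      LinearMap.range (C - 1) ⊔ LinearMap.range (B - 1) := by
    rintro _ ⟨v, rfl⟩
    have hv : (C * B - 1) v = (C - 1) (B v) + (B - 1) v := by simp
    rw [hv]
    exact Submodule.add_mem_sup ⟨_, rfl⟩ ⟨_, rfl⟩
  have h1 := Submodule.finrank_mono hle
  have h2 := Submodule.finrank_sup_add_finrank_inf_eq
    (LinearMap.range (C - 1)) (LinearMap.range (B - 1))
  rw [disjoint_iff, ← Submodule.finrank_eq_zero (R := ℝ)]
  omega

/-- If `S` and `T` are right factors of `A` with additive codimensions and `A` has no nonzero fixed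
vector, then `S` and `T` agree on a large space. The two summands on the left are the dimensions of
the fixed space of `T`, where both are the identity, and of the preimage under `A - 1` of the moved
space of `S`, where both equal `A`. -/
lemma finrank_ker_add_finrank_range_le {A S T C D : V →ₗ[ℝ] V} (hCS : A = C * S) (hDT : A = D * T)
    (hker : LinearMap.ker (A - 1) = ⊥)
    (hS : finrank ℝ (LinearMap.range (C - 1)) + finrank ℝ (LinearMap.range (S - 1)) ≤ finrank ℝ V)
    (hT : finrank ℝ (LinearMap.range (D - 1)) + finrank ℝ (LinearMap.range (T - 1)) ≤ finrank ℝ V)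
    (hfix : LinearMap.ker (T - 1) ≤ LinearMap.ker (S - 1))
    (hmov : LinearMap.range (S - 1) ≤ LinearMap.range (T - 1)) :
    finrank ℝ (LinearMap.ker (T - 1)) + finrank ℝ (LinearMap.range (S - 1)) ≤
      finrank ℝ (LinearMap.ker (T - S)) := by
  have hrank := LinearMap.finrank_range_add_finrank_ker (A - 1)
  rw [hker, finrank_bot, add_zero] at hrank
  have hSA {v : V} (hv : (A - 1) v ∈ LinearMap.range (S - 1)) : A v = S v := by
    subst hCS
    exact apply_eq_of_sub_one_mem_range (disjoint_range_sub_one (by omega)) hv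
  have hTA {v : V} (hv : (A - 1) v ∈ LinearMap.range (T - 1)) : A v = T v := by
    rw [hDT] at hv hrank ⊢
    exact apply_eq_of_sub_one_mem_range (disjoint_range_sub_one (by omega)) hv
  let e := LinearEquiv.ofInjectiveEndo (A - 1) (LinearMap.ker_eq_bot.1 hker)
  let U := (LinearMap.range (S - 1)).comap (A - 1)
  have hU : finrank ℝ U = finrank ℝ (LinearMap.range (S - 1)) := by
    rw [← LinearEquiv.finrank_map_eq e U]
    exact congrArg (fun W : Submodule ℝ V => finrank ℝ W)
      (Submodule.map_comap_eq_of_surjective e.surjective (LinearMap.range (S - 1)))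
  have hUle : U ≤ LinearMap.ker (T - S) := by
    intro v hv
    rw [LinearMap.mem_ker, LinearMap.sub_apply, ← hSA hv, ← hTA (hmov hv), sub_self]
  have hFle : LinearMap.ker (T - 1) ≤ LinearMap.ker (T - S) := by
    intro v hv
    have h1 : T v - v = 0 := hv
    have h2 : S v - v = 0 := hfix hv
    rw [LinearMap.mem_ker, LinearMap.sub_apply, sub_eq_zero.1 h1, sub_eq_zero.1 h2, sub_self]
  have hdis : LinearMap.ker (T - 1) ⊓ U = ⊥ := by
    rw [eq_bot_iff, ← hker]
    rintro v ⟨hv, hvU⟩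
    have h1 : T v - v = 0 := hv
    rw [LinearMap.mem_ker, LinearMap.sub_apply, hTA (hmov hvU), ← h1]
    rfl
  have h1 := Submodule.finrank_sup_add_finrank_inf_eq (LinearMap.ker (T - 1)) U
  rw [hdis, finrank_bot, hU] at h1
  have h2 := Submodule.finrank_mono (sup_le hFle hUle)
  omega

end LinearAlgebra

/-! ### Orbits and invariant functions -/

section FunctionSpaces

variable {X : Type*}

/-- The functions on `X` that are invariant under `τ`. The functions form a `EuclideanSpace`, so that
permutations act by isometries. -/
def invariants (τ : Perm X) : Submodule ℝ (EuclideanSpace ℝ X) where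
  carrier := {f | ∀ x, f (τ x) = f x}
  add_mem' hf hg x := by simp only [PiLp.add_apply, hf x, hg x]
  zero_mem' _ := rfl
  smul_mem' c f hf x := by simp only [PiLp.smul_apply, hf x]

lemma apply_eq_of_sameCycle {τ : Perm X} {f : EuclideanSpace ℝ X} (hf : f ∈ invariants τ)
    {x y : X} (h : τ.SameCycle x y) : f x = f y := by
  obtain ⟨k, rfl⟩ := h
  induction k using Int.induction_on with
  | zero => rfl
  | succ k ih => rw [add_comm, zpow_add, zpow_one, Perm.mul_apply, hf, ih]
  | pred k ih =>
    rw [ih, ← hf ((τ ^ (-(k : ℤ) - 1)) x), ← Perm.mul_apply, ← zpow_one_add,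
      add_sub_cancel]

/-- The functions that factor through a surjection onto `Q` form a space of dimension `|Q|`. -/
lemma finrank_eq_card_of_surjective {Q : Type*} [Finite Q] {π : X → Q}
    (hπ : Function.Surjective π) {W : Submodule ℝ (EuclideanSpace ℝ X)}
    (hW : ∀ f : EuclideanSpace ℝ X, f ∈ W ↔ ∀ x y, π x = π y → f x = f y) :
    finrank ℝ W = Nat.card Q := by
  have := Fintype.ofFinite Q
  let L : (Q → ℝ) →ₗ[ℝ] EuclideanSpace ℝ X :=
    (WithLp.linearEquiv 2 ℝ (X → ℝ)).symm.toLinearMap ∘ₗ LinearMap.funLeft ℝ ℝ π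
  have hL : Function.Injective L :=
    (WithLp.linearEquiv 2 ℝ (X → ℝ)).symm.injective.comp
      (LinearMap.funLeft_injective_of_surjective ℝ ℝ π hπ)
  have hrange : LinearMap.range L = W := by
    ext f
    rw [hW]
    constructor
    · rintro ⟨g, rfl⟩ x y h
      exact congrArg g h
    · intro h
      refine ⟨fun a => f (Function.surjInv hπ a), ?_⟩
      ext x
      exact h _ _ (Function.surjInv_eq hπ (π x))
  rw [← hrange, LinearMap.finrank_range_of_inj hL, finrank_fintype_fun_eq_card,
    Nat.card_eq_fintype_card]

variable [Fintype X]

lemma finrank_invariants [DecidableEq X] (τ : Perm X) :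
    finrank ℝ (invariants τ) = numOrbits τ := by
  let π : X → (orbitPartition τ).parts := fun x =>
    ⟨(orbitPartition τ).part x, (orbitPartition τ).part_mem.2 (Finset.mem_univ x)⟩
  have hπ : Function.Surjective π := by
    rintro ⟨A, hA⟩
    obtain ⟨x, hx⟩ := (orbitPartition τ).nonempty_of_mem_parts hA
    exact ⟨x, Subtype.ext ((orbitPartition τ).part_eq_of_mem hA hx)⟩
  have hπτ (x y : X) : π x = π y ↔ τ.SameCycle x y := by
    rw [← mem_part_orbitPartition, Finpartition.mem_part_iff_part_eq_part _ (Finset.mem_univ _)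
      (Finset.mem_univ _), Subtype.ext_iff]
    exact eq_comm
  rw [finrank_eq_card_of_surjective hπ, Nat.card_eq_fintype_card, Fintype.card_coe, numOrbits]
  intro f
  constructor
  · intro hf x y h
    exact apply_eq_of_sameCycle hf ((hπτ x y).1 h)
  · intro h x
    exact h _ _ ((hπτ _ _).2 (Perm.sameCycle_apply_left.2 (Perm.SameCycle.refl τ x)))

lemma finrank_invariants_inf (τ γ : Perm X) :
    finrank ℝ (invariants τ ⊓ invariants γ : Submodule ℝ (EuclideanSpace ℝ X)) =
      numJointOrbits τ γ := by
  let G := Subgroup.closure ({τ, γ} : Set (Perm X))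
  refine finrank_eq_card_of_surjective
    (π := (Quotient.mk _ : X → MulAction.orbitRel.Quotient G X)) Quotient.mk_surjective ?_
  intro f
  have hrel (x y : X) : (Quotient.mk _ x : MulAction.orbitRel.Quotient G X) = Quotient.mk _ y ↔
      ∃ g ∈ G, g y = x := by
    rw [Quotient.eq, MulAction.orbitRel_apply, MulAction.mem_orbit_iff, Subtype.exists]
    simp only [Subgroup.mk_smul, Perm.smul_def, exists_prop]
  constructor
  · rintro ⟨hτ, hγ⟩ x y h
    obtain ⟨g, hg, rfl⟩ := (hrel x y).1 h
    induction hg using Subgroup.closure_induction generalizing y with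
    | mem g hg =>
      rcases hg with rfl | rfl
      · exact hτ y
      · exact hγ y
    | one => rfl
    | mul a b ha hb iha ihb =>
      rw [Perm.mul_apply, iha _ ((hrel _ _).2 ⟨a, ha, rfl⟩), ihb _ ((hrel _ _).2 ⟨b, hb, rfl⟩)]
    | inv a ha iha =>
      have h1 := iha (a⁻¹ y) ((hrel _ _).2 ⟨a, ha, rfl⟩)
      rw [← h1, ← Perm.mul_apply, mul_inv_cancel, Perm.one_apply]
  · intro h
    have hgen (g : Perm X) (hg : g ∈ ({τ, γ} : Set (Perm X))) : f ∈ invariants g := fun x =>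
      h _ _ ((hrel _ _).2 ⟨g, Subgroup.subset_closure hg, rfl⟩)
    exact ⟨hgen τ (by simp), hgen γ (by simp)⟩

end FunctionSpaces

/-! ### Even and odd functions -/

section Parity

variable {n : ℕ}

/-- The functions `f` with `f (-x) = ε * f x`: the even functions for `ε = 1`, the odd functions for
`ε = -1`. -/
def parityPart (n : ℕ) (ε : ℝ) : Submodule ℝ (EuclideanSpace ℝ (Signed n)) where
  carrier := {f | ∀ x, f (-x) = ε * f x}
  add_mem' hf hg x := by simp only [PiLp.add_apply, hf x, hg x, mul_add]
  zero_mem' _ := by simp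
  smul_mem' c f hf x := by simp only [PiLp.smul_apply, hf x, smul_eq_mul, mul_left_comm]

/-- A space of functions that is stable under `x ↦ -x` is the direct sum of its even and its odd
part. -/
lemma finrank_inf_parityPart_add (W : Submodule ℝ (EuclideanSpace ℝ (Signed n)))
    (hW : ∀ f ∈ W, WithLp.toLp 2 (fun x => f (-x)) ∈ W) :
    finrank ℝ (W ⊓ parityPart n 1 : Submodule ℝ (EuclideanSpace ℝ (Signed n))) +
      finrank ℝ (W ⊓ parityPart n (-1) : Submodule ℝ (EuclideanSpace ℝ (Signed n))) =
      finrank ℝ W := by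
  have hinf : (W ⊓ parityPart n 1) ⊓ (W ⊓ parityPart n (-1)) = ⊥ := by
    rw [eq_bot_iff]
    rintro f ⟨⟨-, h1⟩, -, h2⟩
    rw [Submodule.mem_bot]
    ext x
    have e1 := h1 x
    have e2 := h2 x
    rw [PiLp.zero_apply]
    linarith
  have hsup : (W ⊓ parityPart n 1) ⊔ (W ⊓ parityPart n (-1)) = W := by
    refine le_antisymm (sup_le inf_le_left inf_le_left) fun f hf => ?_
    have hg := hW f hf
    set g : EuclideanSpace ℝ (Signed n) := WithLp.toLp 2 (fun x => f (-x)) with hgdef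
    have hgx (x) : g x = f (-x) := rfl
    have hfg : f = (1 / 2 : ℝ) • (f + g) + (1 / 2 : ℝ) • (f - g) := by module
    rw [hfg]
    refine Submodule.add_mem_sup ⟨W.smul_mem _ (W.add_mem hf hg), fun x => ?_⟩
      ⟨W.smul_mem _ (W.sub_mem hf hg), fun x => ?_⟩
    · simp only [PiLp.smul_apply, PiLp.add_apply, hgx, neg_neg, smul_eq_mul]
      ring
    · simp only [PiLp.smul_apply, PiLp.sub_apply, hgx, neg_neg, smul_eq_mul]
      ring
  have h := Submodule.finrank_sup_add_finrank_inf_eq (W ⊓ parityPart n 1) (W ⊓ parityPart n (-1))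
  rw [hinf, hsup, finrank_bot, add_zero] at h
  exact h.symm

/-- The operator `f ↦ f ∘ τ` on the functions of parity `ε`. It is contravariant in `τ`, see
`precomp_mul`. -/
def precomp (ε : ℝ) (τ : hyperoctahedral n) : parityPart n ε →ₗ[ℝ] parityPart n ε where
  toFun f := ⟨WithLp.toLp 2 fun x => f.1 ((τ : Perm (Signed n)) x), fun x => by
    change f.1 ((τ : Perm (Signed n)) (-x)) = ε * f.1 ((τ : Perm (Signed n)) x)
    rw [τ.2 x, f.2]⟩
  map_add' _ _ := rfl
  map_smul' _ _ := rfl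

lemma precomp_mul (ε : ℝ) (σ τ : hyperoctahedral n) :
    precomp ε (σ * τ) = precomp ε τ * precomp ε σ := rfl

lemma norm_precomp (ε : ℝ) (τ : hyperoctahedral n) (f : parityPart n ε) :
    ‖precomp ε τ f‖ = ‖f‖ := by
  rw [Submodule.coe_norm, Submodule.coe_norm, EuclideanSpace.norm_eq, EuclideanSpace.norm_eq]
  exact congrArg Real.sqrt
    (Equiv.sum_comp (τ : Perm (Signed n)) fun x => ‖f.1 x‖ ^ 2)

lemma map_subtype_ker_precomp (ε : ℝ) (τ : hyperoctahedral n) :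
    (LinearMap.ker (precomp ε τ - 1)).map (parityPart n ε).subtype =
      invariants (τ : Perm (Signed n)) ⊓ parityPart n ε := by
  ext f
  simp only [Submodule.mem_map, LinearMap.mem_ker, LinearMap.sub_apply, Module.End.one_apply,
    sub_eq_zero]
  constructor
  · rintro ⟨f, hf, rfl⟩
    exact ⟨fun x => congrArg (fun g : parityPart n ε => g.1 x) hf, f.2⟩
  · rintro ⟨h1, h2⟩
    refine ⟨⟨f, h2⟩, ?_, rfl⟩
    ext x
    exact h1 x

lemma finrank_ker_precomp (ε : ℝ) (τ : hyperoctahedral n) :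
    finrank ℝ (LinearMap.ker (precomp ε τ - 1)) =
      finrank ℝ (invariants (τ : Perm (Signed n)) ⊓ parityPart n ε :
        Submodule ℝ (EuclideanSpace ℝ (Signed n))) := by
  rw [← map_subtype_ker_precomp, Submodule.finrank_map_subtype_eq]

lemma finrank_even_add_odd_invariants (τ : hyperoctahedral n) :
    finrank ℝ (invariants (τ : Perm (Signed n)) ⊓ parityPart n 1 :
        Submodule ℝ (EuclideanSpace ℝ (Signed n))) +
      finrank ℝ (invariants (τ : Perm (Signed n)) ⊓ parityPart n (-1) :
        Submodule ℝ (EuclideanSpace ℝ (Signed n))) = numOrbits (τ : Perm (Signed n)) := by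
  rw [finrank_inf_parityPart_add, finrank_invariants]
  intro f hf x
  change f (-(τ : Perm (Signed n)) x) = f (-x)
  rw [← τ.2 x, hf]

lemma finrank_parityPart_add :
    finrank ℝ (parityPart n 1) + finrank ℝ (parityPart n (-1)) = Fintype.card (Signed n) := by
  have h := finrank_inf_parityPart_add (n := n) ⊤ (fun _ _ => trivial)
  rwa [top_inf_eq, top_inf_eq, finrank_top, finrank_euclideanSpace] at h

end Parity

/-! ### The reflection length as a codimension -/

section Length

variable {n : ℕ}

/-- The odd functions that are invariant under `τ`. -/
def oddInvariants (τ : Perm (Signed n)) : Submodule ℝ (EuclideanSpace ℝ (Signed n)) :=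
  invariants τ ⊓ parityPart n (-1)

lemma apply_neg_of_mem_oddInvariants {τ : Perm (Signed n)} {f : EuclideanSpace ℝ (Signed n)}
    (hf : f ∈ oddInvariants τ) (x : Signed n) : f (-x) = -f x := by
  rw [hf.2 x, neg_one_mul]

/-- A reflection only exchanges `x` with `y` and `-x` with `-y`, for some `x` and `y`; here
`y = -x` for `(i, -i)`. -/
lemma exists_of_mem_reflections {g : Perm (Signed n)} (hg : g ∈ reflections n) :
    ∃ x y : Signed n, ∀ z, g z = z ∨ (z = x ∧ g z = y) ∨ (z = y ∧ g z = x) ∨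
      (z = -x ∧ g z = -y) ∨ (z = -y ∧ g z = -x) := by
  rcases hg with (⟨i, j, h1, h2, rfl⟩ | ⟨i, j, h1, h2, rfl⟩) | ⟨i, h1, rfl⟩
  · refine ⟨i, j, fun z => ?_⟩
    have h3 : -i ≠ j := by rintro rfl; rw [Signed.coe_neg] at h2; omega
    have h4 : -j ≠ i := by rintro rfl; rw [Signed.coe_neg] at h1 h2; omega
    have h5 := i.neg_ne
    have h6 := j.neg_ne
    rw [Perm.mul_apply]
    grind
  · refine ⟨i, -j, fun z => ?_⟩
    have h3 : i ≠ j := by rintro rfl; omega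
    have h4 : -j ≠ -i := fun h => h3 (neg_injective h).symm
    have h5 := i.neg_ne
    have h6 := j.neg_ne
    rw [Perm.mul_apply, neg_neg]
    grind
  · refine ⟨i, -i, fun z => ?_⟩
    grind

lemma finrank_le_finrank_inf_ker_add_one {V : Type*} [AddCommGroup V] [Module ℝ V]
    [FiniteDimensional ℝ V] (W : Submodule ℝ V) (φ : V →ₗ[ℝ] ℝ) :
    finrank ℝ W ≤ finrank ℝ (W ⊓ LinearMap.ker φ : Submodule ℝ V) + 1 := by
  have h1 := Submodule.finrank_sup_add_finrank_inf_eq W (LinearMap.ker φ)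
  have h2 := LinearMap.finrank_range_add_finrank_ker φ
  have h3 := (LinearMap.range φ).finrank_le
  have h4 := (W ⊔ LinearMap.ker φ).finrank_le
  rw [finrank_self] at h3
  omega

/-- Each reflection in a product imposes one linear condition `f x = f y` on odd invariants. -/
lemma finrank_odd_le_add_length (l : List (Perm (Signed n))) (hl : ∀ g ∈ l, g ∈ reflections n) :
    finrank ℝ (parityPart n (-1)) ≤ finrank ℝ (oddInvariants l.prod) + l.length := by
  induction l with
  | nil =>
    refine Submodule.finrank_mono (fun f hf => ⟨fun x => rfl, hf⟩)
  | cons g l ih =>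
    have ih := ih fun a ha => hl a (List.mem_cons_of_mem _ ha)
    obtain ⟨x, y, hxy⟩ := exists_of_mem_reflections (hl g List.mem_cons_self)
    let φ : EuclideanSpace ℝ (Signed n) →ₗ[ℝ] ℝ :=
      (EuclideanSpace.projₗ x : EuclideanSpace ℝ (Signed n) →ₗ[ℝ] ℝ) - EuclideanSpace.projₗ y
    have h1 := finrank_le_finrank_inf_ker_add_one (oddInvariants l.prod) φ
    have h2 : oddInvariants l.prod ⊓ LinearMap.ker φ ≤ oddInvariants (g :: l).prod := by
      rintro f ⟨hf, hφ⟩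
      have hfxy : f x = f y := sub_eq_zero.1 hφ
      refine ⟨fun z => ?_, hf.2⟩
      rw [List.prod_cons, Perm.mul_apply]
      refine Eq.trans ?_ (hf.1 z)
      have hx := apply_neg_of_mem_oddInvariants hf x
      have hy := apply_neg_of_mem_oddInvariants hf y
      rcases hxy (l.prod z) with h | ⟨h, h'⟩ | ⟨h, h'⟩ | ⟨h, h'⟩ | ⟨h, h'⟩
      · rw [h]
      all_goals rw [h', h]; linarith
    have h3 := Submodule.finrank_mono h2
    rw [List.length_cons]
    omega

/-- The reflection `g` that takes `τ x` back to `x` leaves all odd invariants of `τ` invariant under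
`g * τ`. -/
lemma exists_reflection_mul {τ : Perm (Signed n)} (hτ : τ ∈ hyperoctahedral n) (h1 : τ ≠ 1) :
    ∃ g ∈ reflections n, oddInvariants τ < oddInvariants (g * τ) := by
  obtain ⟨x, hx⟩ : ∃ x, τ x ≠ x := by
    by_contra! h
    exact h1 (Perm.ext h)
  have hneg : τ (-x) = -τ x := hτ x
  obtain ⟨g, hg, hgx, hgs⟩ : ∃ g ∈ reflections n, g (τ x) = x ∧
      ∀ f ∈ oddInvariants τ, ∀ z, f (g z) = f z := by
    by_cases h2 : τ x = -x
    · refine ⟨swap x (-x), swap_mem_reflections x, by rw [h2, swap_apply_right], ?_⟩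
      intro f hf z
      have h3 := hf.1 x
      rw [h2] at h3
      rcases eq_or_ne z x with rfl | hzx
      · rw [swap_apply_left, h3]
      rcases eq_or_ne z (-x) with rfl | hzx'
      · rw [swap_apply_right, h3]
      rw [swap_apply_of_ne_of_ne hzx hzx']
    · have h3 := (τ x).neg_ne
      have h4 := x.neg_ne
      have h5 : -τ x ≠ x := fun h => h2 (neg_eq_iff_eq_neg.1 h)
      have h6 : -τ x ≠ -x := fun h => hx (neg_injective h)
      refine ⟨_, swap_mul_swap_mem hx h2, ?_, ?_⟩
      · rw [Perm.mul_apply, swap_apply_of_ne_of_ne h2 h3.symm, swap_apply_right]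
      · intro f hf z
        have e1 := hf.1 x
        have e2 := hf.1 (-x)
        rw [hneg] at e2
        rw [Perm.mul_apply]
        grind
  obtain ⟨hgB, -⟩ := reflections_subset hg
  refine ⟨g, hg, lt_of_le_of_ne (fun f hf => ⟨fun z => ?_, hf.2⟩) fun heq => ?_⟩
  · rw [Perm.mul_apply, hgs f hf, hf.1]
  -- the odd function `e_x - e_{-x}` is invariant under `g * τ` but not under `τ`
  · have hfix : (g * τ) x = x := hgx
    have hfix' : (g * τ) (-x) = -x := by rw [mul_mem hgB hτ x, hfix]
    let f : EuclideanSpace ℝ (Signed n) :=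
      WithLp.toLp 2 fun z => if z = x then 1 else if z = -x then -1 else 0
    have hf (z) : f z = if z = x then 1 else if z = -x then -1 else 0 := rfl
    have hmem : f ∈ oddInvariants (g * τ) := by
      refine ⟨fun z => ?_, fun z => ?_⟩
      · have i1 : (g * τ) z = x ↔ z = x := by
          rw [← (g * τ).injective.eq_iff (a := z), hfix]
        have i2 : (g * τ) z = -x ↔ z = -x := by
          rw [← (g * τ).injective.eq_iff (a := z), hfix']
        simp only [hf, i1, i2]
      · have hxn := x.neg_ne
        have i1 : -z = x ↔ z = -x := neg_eq_iff_eq_neg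
        have i2 : -z = -x ↔ z = x := neg_inj
        simp only [hf, i1, i2]
        grind
    rw [← heq] at hmem
    have h2 := hmem.1 x
    rw [hf, hf, if_neg hx, if_pos rfl] at h2
    split_ifs at h2 <;> norm_num at h2

lemma exists_factorization_length_le {τ : Perm (Signed n)} (hτ : τ ∈ hyperoctahedral n) :
    ∃ l : List (Perm (Signed n)), (∀ g ∈ l, g ∈ reflections n) ∧ l.prod = τ ∧
      l.length + finrank ℝ (oddInvariants τ) ≤ finrank ℝ (parityPart n (-1)) := by
  have hle (τ : Perm (Signed n)) :
      finrank ℝ (oddInvariants τ) ≤ finrank ℝ (parityPart n (-1)) :=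
    Submodule.finrank_mono inf_le_right
  induction hk : finrank ℝ (parityPart n (-1)) - finrank ℝ (oddInvariants τ)
    using Nat.strong_induction_on generalizing τ with
  | _ k ih =>
    by_cases h1 : τ = 1
    · refine ⟨[], by simp, by simp [h1], ?_⟩
      rw [List.length_nil, zero_add]
      exact hle τ
    obtain ⟨g, hg, hlt⟩ := exists_reflection_mul hτ h1
    obtain ⟨hgB, hgg⟩ := reflections_subset hg
    have hlt' := Submodule.finrank_lt_finrank_of_lt hlt
    have h2 := hle (g * τ)
    obtain ⟨l, hl, hp, hlen⟩ := ih _ (by omega) (mul_mem hgB hτ) rfl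
    refine ⟨g :: l, ?_, ?_, ?_⟩
    · intro a ha
      rcases List.mem_cons.1 ha with rfl | ha
      · exact hg
      · exact hl a ha
    · rw [List.prod_cons, hp, ← mul_assoc, hgg, one_mul]
    · rw [List.length_cons]
      omega

/-- The length of `τ` is the codimension of its odd invariants among all odd functions. -/
lemma length_add_finrank (τ : hyperoctahedral n) :
    length τ + finrank ℝ (oddInvariants (τ : Perm (Signed n))) =
      finrank ℝ (parityPart n (-1)) := by
  apply le_antisymm
  · obtain ⟨l, hl, hp, hlen⟩ := exists_factorization_length_le τ.2
    have h : length τ ≤ l.length := Nat.sInf_le ⟨l, rfl, hl, hp⟩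
    omega
  · obtain ⟨l, h1, h2, h3⟩ := length_spec τ
    have h := finrank_odd_le_add_length l h2
    rw [h3, h1] at h
    omega

end Length

/-! ### Genus zero elements lie below `γ` -/

section Gamma

variable {p q : ℕ}

lemma gamma_mem_hyperoctahedral (hp : 0 < p) (hq : 0 < q) :
    gamma p q ∈ hyperoctahedral (p + q) := by
  intro x
  refine Subtype.ext ?_
  have hx := x.bounds
  change ((gammaFun p q (-x) : Signed (p + q)) : ℤ) = -((gammaFun p q x : Signed (p + q)) : ℤ)
  simp only [gammaFun, Signed.coe_neg]
  push_cast at hx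
  split_ifs <;> omega

/-- Both cycles of `γ` are stable under `x ↦ -x`, so all functions invariant under `γ` are even. -/
lemma apply_neg_of_mem_invariants_gamma (hp : 0 < p) (hq : 0 < q)
    {f : EuclideanSpace ℝ (Signed (p + q))} (hf : f ∈ invariants (gamma p q))
    (x : Signed (p + q)) : f (-x) = f x := by
  -- `F` extends `f` to the integers, by the irrelevant value `0`, so that `F (i + 1)` makes sense
  let F : ℤ → ℝ := fun k => if h : k ∈ (Finset.Icc (-((p + q : ℕ) : ℤ)) (p + q : ℕ)).erase 0
    then f ⟨k, h⟩ else 0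
  have hF (y : Signed (p + q)) : F (y : ℤ) = f y := dif_pos y.2
  have hstep (k l : ℤ) (hk : k ≠ 0 ∧ -((p + q : ℕ) : ℤ) ≤ k ∧ k ≤ ((p + q : ℕ) : ℤ))
      (hl : (if k = p then -1 else if k = -p then 1 else if k = p + q then -(p + 1)
        else if k = -(p + q) then p + 1 else if 0 < k then k + 1 else k - 1 : ℤ) = l) :
      F l = F k := by
    subst hl
    have h := hf ⟨k, by simpa only [Finset.mem_erase, Finset.mem_Icc] using hk⟩
    rw [← hF, ← hF] at h
    exact h
  -- `F` is constant on `1, …, p` and on `-1, …, -p`, and likewise on `±(p+1), …, ±(p+q)`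
  have hpos (i : ℕ) (hi : i < p) : F (i + 1) = F 1 ∧ F (-(i + 1)) = F (-1) := by
    induction i with
    | zero => simp
    | succ i ih =>
      obtain ⟨h1, h2⟩ := ih (by omega)
      rw [← h1, ← h2]
      constructor
      · refine hstep _ _ (by push_cast; omega) ?_
        push_cast
        split_ifs <;> omega
      · refine hstep _ _ (by push_cast; omega) ?_
        push_cast
        split_ifs <;> omega
  have hpos' (i : ℕ) (hi : i < q) : F (p + i + 1) = F (p + 1) ∧ F (-(p + i + 1)) = F (-(p + 1)) := by
    induction i with
    | zero => simp
    | succ i ih =>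
      obtain ⟨h1, h2⟩ := ih (by omega)
      rw [← h1, ← h2]
      constructor
      · refine hstep _ _ (by push_cast; omega) ?_
        push_cast
        split_ifs <;> omega
      · refine hstep _ _ (by push_cast; omega) ?_
        push_cast
        split_ifs <;> omega
  -- `γ` maps `p` to `-1` and `p + q` to `-(p + 1)`
  have hturn : F (-1) = F 1 := by
    obtain ⟨m, rfl⟩ : ∃ m, p = m + 1 := ⟨p - 1, by omega⟩
    rw [← (hpos m (by omega)).1]
    refine hstep _ _ (by push_cast; omega) ?_
    push_cast
    split_ifs <;> omega
  have hturn' : F (-(p + 1)) = F (p + 1) := by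
    obtain ⟨m, rfl⟩ : ∃ m, q = m + 1 := ⟨q - 1, by omega⟩
    rw [← (hpos' m (by omega)).1]
    refine hstep _ _ (by push_cast; omega) ?_
    push_cast
    split_ifs <;> omega
  have hmain (k : ℕ) (hk : 0 < k) (hk' : k ≤ p + q) : F (-k) = F k := by
    rcases le_or_gt k p with h | h
    · obtain ⟨i, rfl⟩ : ∃ i, k = i + 1 := ⟨k - 1, by omega⟩
      obtain ⟨h1, h2⟩ := hpos i (by omega)
      push_cast
      rw [h1, h2, hturn]
    · obtain ⟨i, rfl⟩ : ∃ i, k = p + i + 1 := ⟨k - p - 1, by omega⟩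
      obtain ⟨h1, h2⟩ := hpos' i (by omega)
      push_cast
      rw [h1, h2, hturn']
  have hx := x.bounds
  rw [← hF, ← hF, Signed.coe_neg]
  rcases lt_or_gt_of_ne hx.1 with h | h
  · have h1 := hmain (-(x : ℤ)).toNat (by omega) (by omega)
    rw [Int.toNat_of_nonneg (by omega), neg_neg] at h1
    exact h1.symm
  · have h1 := hmain (x : ℤ).toNat (by omega) (by omega)
    rwa [Int.toNat_of_nonneg (by omega)] at h1

lemma oddInvariants_gamma (hp : 0 < p) (hq : 0 < q) : oddInvariants (gamma p q) = ⊥ := by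
  rw [eq_bot_iff]
  intro f hf
  rw [Submodule.mem_bot]
  ext x
  have h1 := apply_neg_of_mem_invariants_gamma hp hq hf.1 x
  have h2 := apply_neg_of_mem_oddInvariants hf x
  rw [PiLp.zero_apply]
  linarith

/-- The genus-zero condition is the case of equality in the sum of Scott's inequality on even
functions and the subadditivity of the length, which concerns odd functions. -/
lemma le_gamma_of_mem_SBnc (hp : 0 < p) (hq : 0 < q) {τ : hyperoctahedral (p + q)}
    (hτ : τ ∈ SBnc p q) : τ ≤ ⟨gamma p q, gamma_mem_hyperoctahedral hp hq⟩ := by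
  set γ : hyperoctahedral (p + q) := ⟨gamma p q, gamma_mem_hyperoctahedral hp hq⟩ with hγ
  have hgenus : numOrbits (τ : Perm (Signed (p + q))) +
      numOrbits ((τ⁻¹ * γ : hyperoctahedral (p + q)) : Perm (Signed (p + q))) +
      numOrbits (gamma p q) = Fintype.card (Signed (p + q)) +
        2 * numJointOrbits (τ : Perm (Signed (p + q))) (gamma p q) := hτ
  have hscott := scott_inequality (norm_precomp 1 (τ⁻¹ * γ)) (norm_precomp 1 τ)
  rw [← precomp_mul, mul_inv_cancel_left] at hscott
  -- the joint invariants of `τ⁻¹ * γ` and `τ` are those of `τ` and `γ`, all of them even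
  have hjoint : finrank ℝ (LinearMap.ker (precomp 1 (τ⁻¹ * γ) - 1) ⊓
      LinearMap.ker (precomp 1 τ - 1) : Submodule ℝ (parityPart (p + q) 1)) ≤
      numJointOrbits (τ : Perm (Signed (p + q))) (gamma p q) := by
    rw [← finrank_invariants_inf, ← Submodule.finrank_map_subtype_eq]
    refine Submodule.finrank_mono ?_
    refine (Submodule.map_inf_le _).trans ?_
    rw [map_subtype_ker_precomp, map_subtype_ker_precomp]
    rintro f ⟨⟨h1, -⟩, h2, -⟩
    refine ⟨h2, fun x => ?_⟩
    rw [← h1 x]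
    exact (congrArg f ((τ : Perm (Signed (p + q))).apply_symm_apply _).symm).trans (h2 _)
  simp only [finrank_ker_precomp] at hscott
  have e1 := finrank_even_add_odd_invariants τ
  have e2 := finrank_even_add_odd_invariants (τ⁻¹ * γ)
  have e3 := finrank_even_add_odd_invariants γ
  have e4 := finrank_parityPart_add (n := p + q)
  have l1 := length_add_finrank τ
  have l2 := length_add_finrank (τ⁻¹ * γ)
  have l3 := length_add_finrank γ
  have hle := length_mul_le τ (τ⁻¹ * γ)
  rw [mul_inv_cancel_left] at hle
  have hbot : finrank ℝ (oddInvariants (γ : Perm (Signed (p + q)))) = 0 := by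
    rw [hγ, oddInvariants_gamma hp hq, finrank_bot]
  have hγorb : numOrbits (γ : Perm (Signed (p + q))) = numOrbits (gamma p q) := rfl
  unfold oddInvariants at l1 l2 l3 hbot
  rw [le_def]
  omega

end Gamma

/-! ### The partition `Ω̃` and odd invariants -/

section OmegaTilde

variable {n : ℕ}

lemma sameCycle_neg {τ : Perm (Signed n)} (hτ : τ ∈ hyperoctahedral n) {x y : Signed n} :
    τ.SameCycle (-x) (-y) ↔ τ.SameCycle x y := by
  have key (x y : Signed n) (h : τ.SameCycle x y) : τ.SameCycle (-x) (-y) := by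
    obtain ⟨k, rfl⟩ := h
    exact ⟨k, (hyperoctahedral n).zpow_mem hτ k x⟩
  refine ⟨fun h => ?_, key x y⟩
  have h1 := key _ _ h
  rwa [neg_neg, neg_neg] at h1

lemma part_mem_zeroBlocks_iff {τ : Perm (Signed n)} (hτ : τ ∈ hyperoctahedral n) (x : Signed n) :
    (orbitPartition τ).part x ∈ zeroBlocks (orbitPartition τ) ↔ τ.SameCycle x (-x) := by
  rw [zeroBlocks, Finset.mem_filter, Finpartition.part_mem]
  simp only [Finset.mem_univ, true_and]
  constructor
  · intro h
    rw [← mem_part_orbitPartition, h, Finset.mem_neg', neg_neg, Finpartition.mem_part_self]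
    exact Finset.mem_univ x
  · intro h
    ext y
    rw [Finset.mem_neg', mem_part_orbitPartition, mem_part_orbitPartition,
      ← sameCycle_neg hτ (y := -y), neg_neg]
    exact ⟨fun h' => h.symm.trans h', fun h' => h.trans h'⟩

lemma mem_part_omegaTilde (τ : hyperoctahedral n) (x y : Signed n) :
    y ∈ (omegaTilde τ).part x ↔ (τ : Perm (Signed n)).SameCycle x y ∨
      ((τ : Perm (Signed n)).SameCycle x (-x) ∧ (τ : Perm (Signed n)).SameCycle y (-y)) := by
  set π := orbitPartition (τ : Perm (Signed n)) with hπ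
  have hzero (z : Signed n) :
      z ∈ (zeroBlocks π).sup id ↔ (τ : Perm (Signed n)).SameCycle z (-z) := by
    rw [← part_mem_zeroBlocks_iff τ.2, Finset.mem_sup]
    constructor
    · rintro ⟨A, hA, hz⟩
      rwa [π.part_eq_of_mem (Finset.mem_filter.1 hA).1 hz]
    · intro h
      exact ⟨_, h, π.mem_part_self.2 (Finset.mem_univ z)⟩
  have hparts (A : Finset (Signed n)) : A ∈ (omegaTilde τ).parts ↔
      A ≠ ∅ ∧ ((A ∈ π.parts ∧ A ∉ zeroBlocks π) ∨ A = (zeroBlocks π).sup id) := by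
    rw [omegaTilde, mergeZeroBlocks, Finpartition.ofErase_parts, Finset.mem_erase,
      Finset.mem_union, Finset.mem_sdiff, Finset.mem_singleton, Finset.bot_eq_empty]
  rw [Finpartition.mem_part_iff_exists]
  constructor
  · rintro ⟨A, hA, hy, hx⟩
    rcases ((hparts A).1 hA).2 with ⟨h1, -⟩ | rfl
    · left
      rwa [← mem_part_orbitPartition, ← hπ, π.part_eq_of_mem h1 hx]
    · exact Or.inr ⟨(hzero x).1 hx, (hzero y).1 hy⟩
  · intro h
    by_cases hx : (τ : Perm (Signed n)).SameCycle x (-x)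
    · have hy : (τ : Perm (Signed n)).SameCycle y (-y) := by
        rcases h with h | h
        · exact (h.symm.trans hx).trans ((sameCycle_neg τ.2).2 h)
        · exact h.2
      have hxs := (hzero x).2 hx
      exact ⟨_, (hparts _).2 ⟨Finset.ne_empty_of_mem hxs, Or.inr rfl⟩, (hzero y).2 hy, hxs⟩
    · have h1 : (τ : Perm (Signed n)).SameCycle x y := h.resolve_right fun h => hx h.1
      have hxs : x ∈ π.part x := π.mem_part_self.2 (Finset.mem_univ x)
      refine ⟨π.part x, (hparts _).2 ⟨Finset.ne_empty_of_mem hxs, Or.inl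
        ⟨π.part_mem.2 (Finset.mem_univ x), ?_⟩⟩, (mem_part_orbitPartition _ _ _).2 h1, hxs⟩
      rwa [part_mem_zeroBlocks_iff τ.2]

/-- Odd invariants separate a point outside the zero-blocks from all points outside its orbit. -/
lemma exists_oddInvariant_pos {τ : hyperoctahedral n} {x : Signed n}
    (hx : ¬ (τ : Perm (Signed n)).SameCycle x (-x)) :
    ∃ f ∈ oddInvariants (τ : Perm (Signed n)), 0 < f x ∧
      ∀ y, ¬ (τ : Perm (Signed n)).SameCycle x y → f y ≤ 0 := by
  classical
  set t := (τ : Perm (Signed n)) with ht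
  -- the difference of the indicators of the orbits of `x` and `-x`
  let f : EuclideanSpace ℝ (Signed n) :=
    WithLp.toLp 2 fun z => (if t.SameCycle x z then 1 else 0) - if t.SameCycle (-x) z then 1 else 0
  have hf (z) : f z = (if t.SameCycle x z then 1 else 0) -
    if t.SameCycle (-x) z then 1 else 0 := rfl
  refine ⟨f, ⟨fun z => ?_, fun z => ?_⟩, ?_, fun y hy => ?_⟩
  · simp only [hf, Perm.sameCycle_apply_right]
  · have h1 := sameCycle_neg τ.2 (x := x) (y := z)
    have h2 := sameCycle_neg τ.2 (x := -x) (y := z)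
    rw [neg_neg] at h2
    simp only [hf, ht, h1, h2]
    ring
  · have h1 : ¬ t.SameCycle (-x) x := fun h => hx h.symm
    rw [hf, if_pos (Perm.SameCycle.refl t x), if_neg h1]
    norm_num
  · rw [hf, if_neg hy]
    split_ifs <;> norm_num

/-- The blocks of `Ω̃(τ)` are the classes of points that odd invariants of `τ` do not separate. -/
lemma mem_part_omegaTilde_iff_forall (τ : hyperoctahedral n) (x y : Signed n) :
    y ∈ (omegaTilde τ).part x ↔ ∀ f ∈ oddInvariants (τ : Perm (Signed n)), f x = f y := by
  rw [mem_part_omegaTilde]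
  constructor
  · rintro (h | ⟨hx, hy⟩) f hf
    · exact apply_eq_of_sameCycle hf.1 h
    · have h1 := apply_eq_of_sameCycle hf.1 hx
      have h2 := apply_eq_of_sameCycle hf.1 hy
      rw [apply_neg_of_mem_oddInvariants hf] at h1 h2
      linarith
  · intro h
    by_contra! hne
    by_cases hx : (τ : Perm (Signed n)).SameCycle x (-x)
    · obtain ⟨f, hf, hpos, hle⟩ := exists_oddInvariant_pos (hne.2 hx)
      have h1 := hle x fun h' => hne.1 h'.symm
      have h2 := h f hf
      linarith
    · obtain ⟨f, hf, hpos, hle⟩ := exists_oddInvariant_pos hx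
      have h1 := hle y hne.1
      have h2 := h f hf
      linarith

lemma finpartition_le_iff_part {X : Type*} [Fintype X] [DecidableEq X]
    (π ρ : Finpartition (Finset.univ : Finset X)) :
    π ≤ ρ ↔ ∀ x y, y ∈ π.part x → y ∈ ρ.part x := by
  constructor
  · intro h x y hy
    obtain ⟨B, hB, hle⟩ := h (π.part_mem.2 (Finset.mem_univ x))
    rw [ρ.part_eq_of_mem hB (hle (π.mem_part_self.2 (Finset.mem_univ x)))]
    exact hle hy
  · intro h A hA
    obtain ⟨x, hx⟩ := π.nonempty_of_mem_parts hA
    refine ⟨ρ.part x, ρ.part_mem.2 (Finset.mem_univ x), fun y hy => h x y ?_⟩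
    rwa [π.part_eq_of_mem hA hx]

lemma omegaTilde_le_iff (σ τ : hyperoctahedral n) :
    omegaTilde σ ≤ omegaTilde τ ↔
      oddInvariants (τ : Perm (Signed n)) ≤ oddInvariants (σ : Perm (Signed n)) := by
  rw [finpartition_le_iff_part]
  simp only [mem_part_omegaTilde_iff_forall]
  constructor
  · intro h f hf
    refine ⟨fun x => (h x ((σ : Perm (Signed n)) x) (fun g hg => (hg.1 x).symm) f hf).symm, hf.2⟩
  · intro h x y hxy f hf
    exact hxy f (h hf)

end OmegaTilde

/-! ### The order and odd invariants -/

section Order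

variable {n : ℕ}

/-- If `σ ≤ τ`, then the common odd invariants of `σ` and `σ⁻¹ * τ`, which are invariant under `τ`,
have at least the dimension of the odd invariants of `τ`, so the two spaces coincide. -/
lemma oddInvariants_le_of_le {σ τ : hyperoctahedral n} (h : σ ≤ τ) :
    oddInvariants (τ : Perm (Signed n)) ≤ oddInvariants (σ : Perm (Signed n)) := by
  rw [le_def] at h
  set ρ := σ⁻¹ * τ with hρ
  have hτ : τ = σ * ρ := by rw [hρ, mul_inv_cancel_left]
  have hle : oddInvariants (σ : Perm (Signed n)) ⊓ oddInvariants (ρ : Perm (Signed n)) ≤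
      oddInvariants (τ : Perm (Signed n)) := by
    rintro f ⟨h1, h2⟩
    refine ⟨fun x => ?_, h1.2⟩
    rw [hτ, ← h2.1 x]
    exact h1.1 _
  have hsup : oddInvariants (σ : Perm (Signed n)) ⊔ oddInvariants (ρ : Perm (Signed n)) ≤
      parityPart n (-1) := sup_le inf_le_right inf_le_right
  have e1 := Submodule.finrank_sup_add_finrank_inf_eq
    (oddInvariants (σ : Perm (Signed n))) (oddInvariants (ρ : Perm (Signed n)))
  have e2 := Submodule.finrank_mono hsup
  have l1 := length_add_finrank σ
  have l2 := length_add_finrank ρ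
  have l3 := length_add_finrank τ
  rw [← Submodule.eq_of_le_of_finrank_le hle (by omega)]
  exact inf_le_left

/-- The Brady–Watt argument: below a `γ` without nonzero odd invariants, the order is determined by
the odd invariants. -/
lemma le_of_oddInvariants_le {σ τ γ : hyperoctahedral n} (hσ : σ ≤ γ) (hτ : τ ≤ γ)
    (hγ : oddInvariants (γ : Perm (Signed n)) = ⊥)
    (h : oddInvariants (τ : Perm (Signed n)) ≤ oddInvariants (σ : Perm (Signed n))) : σ ≤ τ := by
  have hfin (ρ : hyperoctahedral n) : finrank ℝ (LinearMap.ker (precomp (-1) ρ - 1)) =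
    finrank ℝ (oddInvariants (ρ : Perm (Signed n))) := finrank_ker_precomp _ _
  have hrank (ρ : hyperoctahedral n) :
      finrank ℝ (LinearMap.range (precomp (-1) ρ - 1)) = length ρ := by
    have h1 := LinearMap.finrank_range_add_finrank_ker (precomp (-1) ρ - 1)
    have h2 := length_add_finrank ρ
    rw [hfin] at h1
    omega
  have hfix : LinearMap.ker (precomp (-1) τ - 1) ≤ LinearMap.ker (precomp (-1) σ - 1) := by
    rw [← Submodule.map_le_map_iff_of_injective (parityPart n (-1)).subtype_injective,
      map_subtype_ker_precomp, map_subtype_ker_precomp]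
    exact h
  have hker : LinearMap.ker (precomp (-1) γ - 1) = ⊥ := by
    rw [← Submodule.finrank_eq_zero (R := ℝ), hfin, hγ, finrank_bot]
  have hlen (ρ : hyperoctahedral n) : length ρ ≤ finrank ℝ (parityPart n (-1)) := by
    have := length_add_finrank ρ
    omega
  have hmul (ρ : hyperoctahedral n) :
      precomp (-1) γ = precomp (-1) (ρ⁻¹ * γ) * precomp (-1) ρ := by
    rw [← precomp_mul, mul_inv_cancel_left]
  have hmain := finrank_ker_add_finrank_range_le (hmul σ) (hmul τ) hker
    (by rw [hrank, hrank, add_comm, ← (le_def _ _).1 hσ]; exact hlen γ)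
    (by rw [hrank, hrank, add_comm, ← (le_def _ _).1 hτ]; exact hlen γ)
    hfix (range_sub_one_le_of_ker_le (norm_precomp _ _) (norm_precomp _ _) hfix)
  -- precomposition with `σ` maps the equalizer of `σ` and `τ` into the invariants of `σ⁻¹ * τ`
  have hinj : Function.Injective (precomp (-1) σ) := by
    intro f g hfg
    rw [← sub_eq_zero, ← norm_eq_zero, ← norm_precomp (-1) σ, map_sub, hfg, sub_self, norm_zero]
  have hle : (LinearMap.ker (precomp (-1) τ - precomp (-1) σ)).map (precomp (-1) σ) ≤
      LinearMap.ker (precomp (-1) (σ⁻¹ * τ) - 1) := by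
    rintro _ ⟨f, hf, rfl⟩
    have h1 : precomp (-1) τ f = precomp (-1) σ f := sub_eq_zero.1 hf
    have h2 : precomp (-1) τ = precomp (-1) (σ⁻¹ * τ) * precomp (-1) σ := by
      rw [← precomp_mul, mul_inv_cancel_left]
    rw [LinearMap.mem_ker, LinearMap.sub_apply, Module.End.one_apply, sub_eq_zero, ← h1, h2]
    rw [h2] at h1
    exact congrArg _ h1
  have hfr := Submodule.finrank_mono hle
  rw [← (Submodule.equivMapOfInjective _ hinj _).finrank_eq] at hfr
  rw [hfin, hrank] at hmain
  rw [hfin] at hfr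
  have l2 := length_add_finrank τ
  have l3 := length_add_finrank (σ⁻¹ * τ)
  have hsub := length_mul_le σ (σ⁻¹ * τ)
  rw [mul_inv_cancel_left] at hsub
  rw [le_def]
  omega

end Order

end AnnularNC

open AnnularNC

theorem theorem1p4 (p q : ℕ) (hp : 0 < p) (hq : 0 < q) :
    Function.Bijective (omegaTildeMap p q) ∧
      ∀ σ τ : SBnc p q, σ ≤ τ ↔ omegaTildeMap p q σ ≤ omegaTildeMap p q τ := by
  have hiff (σ τ : SBnc p q) : σ ≤ τ ↔ omegaTildeMap p q σ ≤ omegaTildeMap p q τ := by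
    have h : omegaTildeMap p q σ ≤ omegaTildeMap p q τ ↔ omegaTilde σ.1 ≤ omegaTilde τ.1 := Iff.rfl
    rw [h, omegaTilde_le_iff]
    exact ⟨fun h => oddInvariants_le_of_le h, le_of_oddInvariants_le
      (le_gamma_of_mem_SBnc hp hq σ.2) (le_gamma_of_mem_SBnc hp hq τ.2)
      (oddInvariants_gamma hp hq)⟩
  refine ⟨⟨fun σ τ h => le_antisymm ((hiff σ τ).2 h.le) ((hiff τ σ).2 h.ge), ?_⟩, hiff⟩
  rintro ⟨_, τ, hτ, rfl⟩
  exact ⟨⟨τ, hτ⟩, rfl⟩
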